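/- Let $N\ge 1$ qubits (basis $|0\rangle,|1\rangle$) sit on the sites of a finite set $V$, $|V|=N$. Let $s_i^\dagger$ be the operator with $s_i^\dagger|0\rangle=|1\rangle$, $s_i^\dagger|1\rangle=0$ on site $i$, let $s_i$ be its Hermitian conjugate, and for $0\le p\le N$ let $|W^p\rangle\propto\big(\sum_{i\in V}s_i^\dagger\big)^p|0\cdots0\rangle$ be the normalized Dicke states. Every operator is a unique linear combination of normal-ordered strings $s^\dagger_{j_1}\cdots s^\dagger_{j_n}s_{k_1}\cdots s_{k_m}$ (with $j_1,\dots,j_n$ distinct and $k_1,\dots,k_m$ distinct, up to reordering commuting factors). An operator $H$, Hermitian or not, is called $k$-local if every string occurring in it involves at most $k$ distinct sites. Given a graph with vertex set $V$, $H$ is said to have range (at most) $R$ if in every string occurring in it any two sites are at graph distance strictly less than $R$ (sites in different connected components are at infinite distance). An operator is supported on $X\subseteq V$ if all its strings involve only sites of $X$. (a) Let $G$ be a graph with vertex set $V$ and maximum degree at most $\Delta$, and let $H$ be $k$-local and of range $R$ with respect to $G$, where $$N>2k\,(\Delta^{4R}+1)$$ (with $0^0=1$). If $H|W^p\rangle=E_p|W^p\rangle$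 for all $p=0,1,\dots,N$, then there are constants $\Omega,\omega\in\mathbb C$ with $E_p=\Omega+\omega p$ for all $p=0,1,\dots,N$. If $H$ is Hermitian, $\Omega$ and $\omega$ are real. (b) Let $H=\sum_a h_a$ be a finite sum in which each $h_a$ is supported on a set $X_a\subseteq V$ with $|X_a|\le k$, and suppose that every site lies in at most $T$ of the sets $X_a$ (no graph is given). Suppose $$N>2k\,\big(((k-1)T)^{8}+1\big)$$ (where $k-1$ is read as $0$ if $k=0$). If $H|W^p\rangle=E_p|W^p\rangle$ for all $p=0,1,\dots,N$, then there are constants $\Omega,\omega\in\mathbb C$ with $E_p=\Omega+\omega p$ for all $p=0,1,\dots,N$. If $H$ is Hermitian, $\Omega$ and $\omega$ are real. -/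

import Mathlib

open scoped Matrix

noncomputable section

namespace Dicke

variable {V : Type*} [Fintype V] [DecidableEq V]

/-- Occupation configurations of one qubit per site of `V`; they label the computational basis
of the Hilbert space `(ℂ²)^{⊗ V}`. The value `1` at a site means that the site is occupied. -/
abbrev Config (V : Type*) : Type _ := V → Fin 2

/-- Linear operators on `(ℂ²)^{⊗ V}`, as matrices in the computational basis. -/
abbrev Operator (V : Type*) : Type _ := Matrix (Config V) (Config V) ℂ

/-- State vectors of `(ℂ²)^{⊗ V}`, as amplitudes in the computational basis. -/
abbrev State (V : Type*) : Type _ := Config V → ℂ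

/-- The creation operator `s†_i`: it sends `|0⟩` to `|1⟩` and `|1⟩` to `0` at the site `i`,
and acts as the identity on all other sites. -/
def raise (i : V) : Operator V :=
  Matrix.of fun σ τ => if τ i = 0 ∧ σ = Function.update τ i 1 then 1 else 0

/-- The annihilation operator `s_i`, the Hermitian conjugate of `s†_i`. -/
def lower (i : V) : Operator V := (raise i)ᴴ

/-- The vacuum `|0…0⟩`. -/
def vacuum : State V := Pi.single (fun _ => 0) 1

/-- The total raising operator `S† = ∑ i, s†_i`. -/
def totalRaise : Operator V := ∑ i : V, raise i

/-- The Dicke state `|W^p⟩ ∝ (S†)^p |0…0⟩`, normalized in the Hilbert-space (`ℓ²`) norm. -/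
def dicke (p : ℕ) : State V :=
  let v : State V := (totalRaise ^ p) *ᵥ vacuum
  ((‖WithLp.toLp 2 v‖⁻¹ : ℝ) : ℂ) • v

/-- The operator string `s†_{j₁} ⋯ s†_{jₙ} s_{k₁} ⋯ s_{kₘ}`, for `l = [j₁, …, jₙ]` and
`m = [k₁, …, kₘ]`. -/
def opString (l m : List V) : Operator V := (l.map raise).prod * (m.map lower).prod

/-- The operators all of whose normal-ordered strings have a set of sites satisfying `P`. In a
string the creation sites are distinct and the annihilation sites are distinct; up to the order
of commuting factors these strings form a basis of the space of operators, so lying in the span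
of some of them means that no other string occurs in the expansion. -/
def stringSpan (P : Finset V → Prop) : Submodule ℂ (Operator V) :=
  Submodule.span ℂ {A | ∃ l m : List V, l.Nodup ∧ m.Nodup ∧
    P (l.toFinset ∪ m.toFinset) ∧ A = opString l m}

/-- `H` is `k`-local: every operator string in it involves at most `k` sites. -/
def IsKLocal (k : ℕ) (H : Operator V) : Prop :=
  H ∈ stringSpan (fun X : Finset V => X.card ≤ k)

/-- `H` has range (at most) `R` with respect to the graph `G`: in every operator string in it,
any two sites are at graph distance strictly less than `R`. Sites in different components of
`G` are at infinite distance. -/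
def HasRange (G : SimpleGraph V) (R : ℕ) (H : Operator V) : Prop :=
  H ∈ stringSpan (fun X : Finset V => ∀ i ∈ X, ∀ j ∈ X, G.edist i j < (R : ℕ∞))

/-- `A` is supported on the set of sites `X`: it is built from operator strings on `X`. -/
def SupportedOn (X : Finset V) (A : Operator V) : Prop :=
  A ∈ stringSpan (fun Y : Finset V => Y ⊆ X)

end Dicke

end

/-!
Apply the operator `H` to the sum of all computational basis states. This vector is the sum of the
(unnormalized) Dicke states, so the eigenvalue equations say that the amplitude of the image at a
configuration `σ` is `E |σ|`, where `|σ|` is the number of occupied sites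
(`mulVec_one_eq_of_eigen`). An operator string on a set of sites `X`, on the other hand, maps the
constant vector to a function of the coordinates in `X` only (`dependsOn_opString_mulVec`).

For a set of sites `A`, take the alternating sum of the amplitudes over the configurations
occupied within `A`, i.e. the coefficient of `∏ i ∈ A, σ i` in the multilinear expansion. It
vanishes for every function that ignores some coordinate in `A`, hence for the image under an
operator all of whose strings fail to cover `A`. For the function `E |σ|` it is the forward
difference of order `|A|` of `E` at `0`
(`altSum_comp_weight`). Consequently, if two distinct sites `i`, `j` are not covered by a common
string, then all differences of order `2, …, N` vanish, because each such order is the size of some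
set containing `i` and `j`, and Newton's formula makes `E` affine on `0, …, N`.

Such a pair of sites exists as soon as the sites that share a string with a given one do not
exhaust `V`. For range `R` these sites lie in a ball of radius below `R`, which has at most
`(Δ + 1) ^ R` sites in general and at most two sites when `Δ ≤ 1`; for a sum of local terms there
are at most `1 + (k - 1) T` of them. For `k = 0` only multiples of the identity occur, and no
nonempty set is covered.
-/

namespace Dicke

variable {V : Type*} [DecidableEq V]

/-! ### Alternating sums over subsets -/

/-- The configuration whose set of occupied sites is `B`. -/
def configOf (B : Finset V) : Config V := fun i => if i ∈ B then 1 else 0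

/-- The coefficient of the monomial `∏ i ∈ A, σ i` in the multilinear expansion of `f`, given by
Möbius inversion over the subsets of `A`. -/
def altSum (A : Finset V) (f : State V) : ℂ :=
  ∑ B ∈ A.powerset, (-1) ^ (A.card - B.card) * f (configOf B)

lemma altSum_add (A : Finset V) (f g : State V) :
    altSum A (f + g) = altSum A f + altSum A g := by
  simp [altSum, mul_add, Finset.sum_add_distrib]

lemma altSum_smul (A : Finset V) (c : ℂ) (f : State V) : altSum A (c • f) = c * altSum A f := by
  simp only [altSum, Pi.smul_apply, smul_eq_mul, Finset.mul_sum]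
  exact Finset.sum_congr rfl fun _ _ => by ring

/-- If `f` ignores the coordinate `i ∈ A`, the terms of `B` and `insert i B` cancel. -/
lemma altSum_eq_zero_of_dependsOn {A X : Finset V} (hAX : ¬ A ⊆ X) {f : State V}
    (hf : DependsOn f (X : Set V)) : altSum A f = 0 := by
  obtain ⟨i, hiA, hiX⟩ := Finset.not_subset.1 hAX
  obtain ⟨A, hi, rfl⟩ : ∃ A' : Finset V, i ∉ A' ∧ A = insert i A' :=
    ⟨A.erase i, Finset.notMem_erase i A, (Finset.insert_erase hiA).symm⟩
  rw [altSum, Finset.sum_powerset_insert hi, ← Finset.sum_add_distrib]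
  refine Finset.sum_eq_zero fun B hB => ?_
  have hBA := Finset.mem_powerset.1 hB
  have hiB : i ∉ B := fun h => hi (hBA h)
  have hval : f (configOf (insert i B)) = f (configOf B) := by
    refine hf fun j hj => ?_
    have : j ≠ i := by rintro rfl; exact hiX hj
    simp [configOf, this]
  have hc : B.card ≤ A.card := Finset.card_le_card hBA
  rw [hval, Finset.card_insert_of_notMem hi, Finset.card_insert_of_notMem hiB,
    Nat.add_sub_add_right, Nat.succ_sub hc, pow_succ]
  ring

/-! ### Operator strings acting on functions of few coordinates -/

lemma dependsOn_update {X : Set V} {g : State V} (hg : DependsOn g X) (i : V) (a : Fin 2) :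
    DependsOn (fun σ => g (Function.update σ i a)) (insert i X) := by
  intro σ τ h
  refine hg fun j hj => ?_
  by_cases hji : j = i
  · subst hji; simp
  · simp [hji, h j (Set.mem_insert_of_mem _ hj)]

variable [Fintype V]

lemma raise_mulVec (i : V) (g : State V) (σ : Config V) :
    (raise i *ᵥ g) σ = if σ i = 1 then g (Function.update σ i 0) else 0 := by
  have key : ∀ τ : Config V, (τ i = 0 ∧ σ = Function.update τ i 1) ↔
      (σ i = 1 ∧ τ = Function.update σ i 0) := by
    intro τ
    constructor
    · rintro ⟨h, rfl⟩
      simp [← h]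
    · rintro ⟨h, rfl⟩
      simp [← h]
  simp only [Matrix.mulVec, dotProduct, raise, Matrix.of_apply, key]
  by_cases h : σ i = 1 <;> simp [h]

lemma lower_mulVec (i : V) (g : State V) (σ : Config V) :
    (lower i *ᵥ g) σ = if σ i = 0 then g (Function.update σ i 1) else 0 := by
  simp only [Matrix.mulVec, dotProduct, lower, raise, Matrix.conjTranspose_apply, Matrix.of_apply]
  by_cases h : σ i = 0 <;> simp [h, apply_ite (star : ℂ → ℂ)]

lemma dependsOn_raise_mulVec {X : Set V} {g : State V} (hg : DependsOn g X) (i : V) :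
    DependsOn (raise i *ᵥ g) (insert i X) := by
  intro σ τ h
  rw [raise_mulVec, raise_mulVec, h i (Set.mem_insert _ _)]
  exact congrArg (fun z => ite _ z _) (dependsOn_update hg i 0 h)

lemma dependsOn_lower_mulVec {X : Set V} {g : State V} (hg : DependsOn g X) (i : V) :
    DependsOn (lower i *ᵥ g) (insert i X) := by
  intro σ τ h
  rw [lower_mulVec, lower_mulVec, h i (Set.mem_insert _ _)]
  exact congrArg (fun z => ite _ z _) (dependsOn_update hg i 1 h)

lemma dependsOn_prod_mulVec {F : V → Operator V}
    (hF : ∀ (i : V) (X : Set V) (g : State V), DependsOn g X → DependsOn (F i *ᵥ g) (insert i X))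
    (l : List V) {X : Set V} {g : State V} (hg : DependsOn g X) :
    DependsOn ((l.map F).prod *ᵥ g) ({i | i ∈ l} ∪ X) := by
  induction l with
  | nil => simpa using hg
  | cons i l ih =>
    rw [List.map_cons, List.prod_cons, ← Matrix.mulVec_mulVec]
    refine (hF i _ _ ih).mono ?_
    rintro j (rfl | hj | hj) <;> simp_all

lemma dependsOn_opString_mulVec (l m : List V) :
    DependsOn (opString l m *ᵥ (1 : State V)) (l.toFinset ∪ m.toFinset : Finset V) := by
  rw [opString, ← Matrix.mulVec_mulVec]
  have h1 : DependsOn (1 : State V) ∅ := dependsOn_const 1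
  refine (dependsOn_prod_mulVec (fun i _ _ h => dependsOn_raise_mulVec h i) l
    (dependsOn_prod_mulVec (fun i _ _ h => dependsOn_lower_mulVec h i) m h1)).mono ?_
  intro j hj
  simpa using hj

/-- An operator none of whose strings covers `A` produces no monomial `∏ i ∈ A, σ i`. -/
lemma altSum_mulVec_one_eq_zero {P : Finset V → Prop} {A : Finset V} (hA : ∀ X, P X → ¬ A ⊆ X)
    {H : Operator V} (hH : H ∈ stringSpan P) : altSum A (H *ᵥ 1) = 0 := by
  induction hH using Submodule.span_induction with
  | mem H h =>
    obtain ⟨l, m, -, -, hP, rfl⟩ := h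
    exact altSum_eq_zero_of_dependsOn (hA _ hP) (dependsOn_opString_mulVec l m)
  | zero => simp [altSum]
  | add H K _ _ h1 h2 => rw [Matrix.add_mulVec, altSum_add, h1, h2, add_zero]
  | smul c H _ h => rw [Matrix.smul_mulVec, altSum_smul, h, mul_zero]

/-! ### Functions of the number of occupied sites -/

/-- The number of occupied sites. -/
def weight (σ : Config V) : ℕ := (Finset.univ.filter fun i => σ i = 1).card

lemma weight_configOf (B : Finset V) : weight (configOf B) = B.card := by
  simp [weight, configOf]

lemma weight_le {V : Type*} [Fintype V] (σ : Config V) : weight σ ≤ Fintype.card V := Finset.card_le_univ _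

lemma altSum_comp_weight (A : Finset V) (E : ℕ → ℂ) :
    altSum A (fun σ => E (weight σ)) = (fwdDiff 1)^[A.card] E 0 := by
  rw [fwdDiff_iter_eq_sum_shift, altSum]
  simp only [weight_configOf]
  rw [Finset.sum_powerset_apply_card (fun n => (-1 : ℂ) ^ (A.card - n) * E n)]
  refine Finset.sum_congr rfl fun n _ => ?_
  simp
  ring

/-! ### Dicke states -/

/-- The unnormalized Dicke state: the sum of the basis states with `p` occupied sites. -/
def weightState (p : ℕ) : State V := fun σ => if weight σ = p then 1 else 0

lemma weight_update_zero {σ : Config V} {i : V} (h : σ i = 1) :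
    weight (Function.update σ i 0) + 1 = weight σ := by
  have : (Finset.univ.filter fun j => Function.update σ i 0 j = 1) =
      (Finset.univ.filter fun j => σ j = 1).erase i := by
    ext j
    by_cases hj : j = i
    · subst hj; simp
    · simp [hj]
  rw [weight, this, Finset.card_erase_add_one (by simp [h]), weight]

lemma totalRaise_mulVec_weightState (p : ℕ) :
    totalRaise *ᵥ (weightState p : State V) = ((p + 1 : ℕ) : ℂ) • weightState (p + 1) := by
  funext σ
  have h1 : ∀ i, (raise i *ᵥ (weightState p : State V)) σ =
      if σ i = 1 then weightState (p + 1) σ else 0 := by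
    intro i
    rw [raise_mulVec]
    split_ifs with h
    · simp only [weightState, ← weight_update_zero h, Nat.add_right_cancel_iff]
    · rfl
  rw [totalRaise, Matrix.sum_mulVec, Finset.sum_apply, Finset.sum_congr rfl fun i _ => h1 i,
    ← Finset.sum_filter, Finset.sum_const]
  change weight σ • weightState (p + 1) σ = _
  by_cases h : weight σ = p + 1 <;> simp [weightState, h]

lemma vacuum_eq_weightState {V : Type*} [Fintype V] : (vacuum : State V) = weightState 0 := by
  funext σ
  have : weight σ = 0 ↔ σ = fun _ => 0 := by
    simp only [weight, Finset.card_eq_zero, Finset.filter_eq_empty_iff, Finset.mem_univ,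
      forall_const, funext_iff]
    exact forall_congr' fun i => by generalize σ i = a; fin_cases a <;> simp
  simp [vacuum, weightState, this, Pi.single_apply]

lemma totalRaise_pow_mulVec_vacuum (p : ℕ) :
    (totalRaise ^ p) *ᵥ (vacuum : State V) = (p.factorial : ℂ) • weightState p := by
  induction p with
  | zero => simp [vacuum_eq_weightState]
  | succ p ih =>
    rw [pow_succ', ← Matrix.mulVec_mulVec, ih, Matrix.mulVec_smul, totalRaise_mulVec_weightState,
      smul_smul, Nat.factorial_succ, ← Nat.cast_mul, mul_comm]

lemma weightState_ne_zero {p : ℕ} (hp : p ≤ Fintype.card V) : (weightState p : State V) ≠ 0 := by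
  obtain ⟨B, -, hB⟩ := Finset.exists_subset_card_eq (s := (Finset.univ : Finset V)) hp
  intro h
  have := congrFun h (configOf B)
  simp [weightState, weight_configOf, hB] at this

lemma mulVec_weightState {p : ℕ} (hp : p ≤ Fintype.card V) {H : Operator V} {e : ℂ}
    (h : H *ᵥ dicke p = e • dicke p) : H *ᵥ weightState p = e • (weightState p : State V) := by
  obtain ⟨c, hc, hd⟩ : ∃ c : ℂ, c ≠ 0 ∧ (dicke p : State V) = c • weightState p := by
    refine ⟨_, ?_, by rw [dicke, totalRaise_pow_mulVec_vacuum, smul_smul]⟩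
    refine mul_ne_zero ?_ (Nat.cast_ne_zero.2 p.factorial_ne_zero)
    rw [Complex.ofReal_ne_zero]
    refine inv_ne_zero (norm_ne_zero_iff.2 fun h0 => ?_)
    rw [WithLp.toLp_eq_zero, smul_eq_zero] at h0
    exact h0.elim (Nat.cast_ne_zero.2 p.factorial_ne_zero) (weightState_ne_zero hp)
  rw [hd, Matrix.mulVec_smul, smul_comm e c] at h
  exact smul_right_injective _ hc h

/-- The constant vector is the sum of all the Dicke states, so its image is read off from the
eigenvalue equations. -/
lemma mulVec_one_eq_of_eigen {H : Operator V} {E : ℕ → ℂ}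
    (h : ∀ p ≤ Fintype.card V, H *ᵥ dicke p = E p • dicke p) :
    H *ᵥ 1 = fun σ => E (weight σ) := by
  have h1 : (1 : State V) = ∑ p ∈ Finset.range (Fintype.card V + 1), weightState p := by
    funext σ
    simp [weightState, weight_le]
  rw [h1, Matrix.mulVec_sum, Finset.sum_congr rfl fun p hp =>
    mulVec_weightState (Nat.lt_succ_iff.1 (Finset.mem_range.1 hp))
      (h p (Nat.lt_succ_iff.1 (Finset.mem_range.1 hp)))]
  funext σ
  simp [weightState, weight_le]

open scoped ComplexOrder in
lemma im_eq_zero_of_isHermitian {H : Operator V} (hH : H.IsHermitian) {e : ℂ} {x : State V}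
    (hx : x ≠ 0) (h : H *ᵥ x = e • x) : e.im = 0 := by
  have hq : star (star x ⬝ᵥ (H *ᵥ x)) = star x ⬝ᵥ (H *ᵥ x) := by
    rw [← Matrix.star_dotProduct_star, star_star, Matrix.star_mulVec, hH.eq, ← Matrix.dotProduct_mulVec]
  have hn : star (star x ⬝ᵥ x) = star x ⬝ᵥ x := by
    rw [← Matrix.star_dotProduct_star, star_star]
  rw [h, dotProduct_smul, smul_eq_mul, star_mul', hn] at hq
  exact Complex.conj_eq_iff_im.1
    (mul_right_cancel₀ (fun h0 => hx (dotProduct_star_self_eq_zero.1 h0)) hq)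

/-! ### Affine spectra -/

/-- Newton's formula: a sequence whose differences of order `2, …, N` at `0` vanish is affine
up to `N`. -/
lemma eq_affine_of_fwdDiff_eq_zero {E : ℕ → ℂ} {N : ℕ}
    (h : ∀ n, 2 ≤ n → n ≤ N → (fwdDiff 1)^[n] E 0 = 0) {p : ℕ} (hp : p ≤ N) :
    E p = E 0 + (E 1 - E 0) * p := by
  have key := shift_eq_sum_fwdDiff_iter 1 E p 0
  rcases p with _ | p
  · simp
  rw [Finset.sum_range_succ', Finset.sum_range_succ', Finset.sum_eq_zero] at key
  · simp [fwdDiff] at key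
    rw [key]
    push_cast
    ring
  · intro n hn
    rw [Finset.mem_range] at hn
    rw [h _ (by omega) (by omega), smul_zero]

/-- If every size from `2` to `N` is realized by a set of sites which no string of `H` can cover,
then the tower of eigenvalues is affine. -/
lemma affine_spectrum {H : Operator V} {E : ℕ → ℂ} (hV : 0 < Fintype.card V)
    (hE : ∀ p ≤ Fintype.card V, H *ᵥ dicke p = E p • dicke p)
    (hA : ∀ n, 2 ≤ n → n ≤ Fintype.card V →
      ∃ A : Finset V, A.card = n ∧ altSum A (H *ᵥ 1) = 0) :
    ∃ Ω ω : ℂ, (∀ p ≤ Fintype.card V, E p = Ω + ω * (p : ℂ)) ∧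
      (H.IsHermitian → Ω.im = 0 ∧ ω.im = 0) := by
  refine ⟨E 0, E 1 - E 0, fun p hp => eq_affine_of_fwdDiff_eq_zero (fun n h2 hn => ?_) hp,
    fun hH => ?_⟩
  · obtain ⟨A, rfl, h0⟩ := hA n h2 hn
    rwa [mulVec_one_eq_of_eigen hE, altSum_comp_weight] at h0
  · have him : ∀ p ≤ Fintype.card V, (E p).im = 0 := fun p hp =>
      im_eq_zero_of_isHermitian hH (weightState_ne_zero hp) (mulVec_weightState hp (hE p hp))
    rw [Complex.sub_im, him 0 hV.le, him 1 hV, sub_zero]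
    exact ⟨rfl, rfl⟩

/-- The case of multiples of the identity. It is treated apart because there may be a single site,
so that no two distinct sites are available. -/
lemma affine_spectrum_of_card_le_zero {P : Finset V → Prop} (hP : ∀ X, P X → X.card ≤ 0)
    {H : Operator V} {E : ℕ → ℂ} (hV : 0 < Fintype.card V) (hH : H ∈ stringSpan P)
    (hE : ∀ p ≤ Fintype.card V, H *ᵥ dicke p = E p • dicke p) :
    ∃ Ω ω : ℂ, (∀ p ≤ Fintype.card V, E p = Ω + ω * (p : ℂ)) ∧
      (H.IsHermitian → Ω.im = 0 ∧ ω.im = 0) := by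
  refine affine_spectrum hV hE fun n h2 hn => ?_
  obtain ⟨A, -, hA⟩ := Finset.exists_subset_card_eq (s := (Finset.univ : Finset V)) hn
  refine ⟨A, hA, altSum_mulVec_one_eq_zero (fun X hX hAX => ?_) hH⟩
  have := Finset.card_le_card hAX
  have := hP X hX
  omega

/-- It suffices that the sites sharing an admissible set with a fixed site `i` lie in a set `S`
(containing `i`) which is not all of `V`. -/
lemma affine_spectrum_of_neighborhood {P : Finset V → Prop} {H : Operator V} {E : ℕ → ℂ}
    (hH : H ∈ stringSpan P) (hE : ∀ p ≤ Fintype.card V, H *ᵥ dicke p = E p • dicke p)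
    {i : V} {S : Finset V} (hi : i ∈ S) (hS : S.card < Fintype.card V)
    (hPS : ∀ X, P X → i ∈ X → X ⊆ S) :
    ∃ Ω ω : ℂ, (∀ p ≤ Fintype.card V, E p = Ω + ω * (p : ℂ)) ∧
      (H.IsHermitian → Ω.im = 0 ∧ ω.im = 0) := by
  refine affine_spectrum (by omega) hE fun n h2 hn => ?_
  obtain ⟨j, hj⟩ : ∃ j, j ∉ S := by
    by_contra! h
    exact hS.ne (by rw [Finset.eq_univ_of_forall h, Finset.card_univ])
  have hij : i ≠ j := by rintro rfl; exact hj hi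
  obtain ⟨A, hA, -, hAn⟩ := Finset.exists_subsuperset_card_eq (Finset.subset_univ {i, j})
    (n := n) (by rwa [Finset.card_pair hij]) (by rwa [Finset.card_univ])
  exact ⟨A, hAn, altSum_mulVec_one_eq_zero (fun X hX hAX =>
    hj (hPS X hX (hAX (hA (by simp))) (hAX (hA (by simp))))) hH⟩

/-! ### Sites sharing a term with a given site -/

lemma exists_card_le_of_walk (G : SimpleGraph V) [DecidableRel G.Adj] {Δ : ℕ}
    (hΔ : ∀ i, G.degree i ≤ Δ) (n : ℕ) (i : V) :
    ∃ S : Finset V, S.card ≤ (Δ + 1) ^ n ∧ ∀ (v : V) (w : G.Walk i v), w.length ≤ n → v ∈ S := by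
  induction n generalizing i with
  | zero =>
    refine ⟨{i}, by simp, fun v w hw => ?_⟩
    rw [← SimpleGraph.Walk.eq_of_length_eq_zero (Nat.le_zero.1 hw)]
    simp
  | succ n ih =>
    choose S hS hw using ih
    refine ⟨insert i ((G.neighborFinset i).biUnion S), ?_, fun v w hwl => ?_⟩
    · have h1 : ((G.neighborFinset i).biUnion S).card ≤ Δ * (Δ + 1) ^ n :=
        Finset.card_biUnion_le.trans <| (Finset.sum_le_card_nsmul _ _ _ fun j _ => hS j).trans <| by
          rw [SimpleGraph.card_neighborFinset_eq_degree, smul_eq_mul]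
          exact Nat.mul_le_mul_right _ (hΔ i)
      have h2 : 1 ≤ (Δ + 1) ^ n := Nat.one_le_pow _ _ (Nat.succ_pos _)
      have h3 := Finset.card_insert_le i ((G.neighborFinset i).biUnion S)
      rw [pow_succ', add_mul]
      omega
    · cases w with
      | nil => simp
      | @cons _ j _ hadj w =>
        refine Finset.mem_insert_of_mem (Finset.mem_biUnion.2 ⟨j, by simpa using hadj, ?_⟩)
        exact hw j v w (by simpa using hwl)

/-- In a graph of maximum degree at most one, a connected component has at most two vertices. -/
lemma exists_card_le_two_of_walk (G : SimpleGraph V) [DecidableRel G.Adj]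
    (hΔ : ∀ i, G.degree i ≤ 1) (i : V) :
    ∃ S : Finset V, S.card ≤ 2 ∧ ∀ (v : V), G.Walk i v → v ∈ S := by
  refine ⟨insert i (G.neighborFinset i), ?_, fun v w => ?_⟩
  · have h1 := Finset.card_insert_le i (G.neighborFinset i)
    have h2 := hΔ i
    rw [← SimpleGraph.card_neighborFinset_eq_degree] at h2
    omega
  · have closed : ∀ {u v : V}, G.Walk u v → u ∈ insert i (G.neighborFinset i) →
        v ∈ insert i (G.neighborFinset i) := by
      intro u v w
      induction w with
      | nil => exact id
      | @cons a b _ hab _ ih =>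
        intro ha
        refine ih ?_
        rcases Finset.mem_insert.1 ha with rfl | ha
        · exact Finset.mem_insert_of_mem (by simpa using hab)
        · -- `a` is a neighbor of `i`, and its only neighbor is `i`
          have hc := hΔ a
          rw [← SimpleGraph.card_neighborFinset_eq_degree, Finset.card_le_one] at hc
          have : b = i := hc b (by simpa using hab) i (by simpa [G.adj_comm] using ha)
          simp [this]
    exact closed w (Finset.mem_insert_self _ _)

/-- The bound `(Δ + 1) ^ R` on balls is at most `Δ ^ (4 * R)` when `Δ ≥ 2`. For `Δ ≤ 1` it is
replaced by the size of a component, which is `1` for `Δ = 0` and at most `2` for `Δ = 1`. -/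
lemma exists_ball_card_lt (G : SimpleGraph V) [DecidableRel G.Adj] {Δ : ℕ}
    (hΔ : ∀ i, G.degree i ≤ Δ) (R : ℕ) (i : V) :
    ∃ S : Finset V, i ∈ S ∧ S.card < 2 * (Δ ^ (4 * R) + 1) ∧
      ∀ v, G.edist i v < R → v ∈ S := by
  have walk : ∀ v, G.edist i v < R → ∃ w : G.Walk i v, w.length ≤ R := by
    intro v hv
    obtain ⟨w, hw⟩ := SimpleGraph.exists_walk_of_edist_ne_top (ne_top_of_lt hv)
    rw [← hw] at hv
    exact ⟨w, (Nat.cast_lt.1 hv).le⟩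
  rcases le_or_gt Δ 1 with h1 | h1
  · rcases Nat.eq_zero_or_pos Δ with rfl | hpos
    · -- without edges the ball is a single site
      obtain ⟨S, hS, hw⟩ := exists_card_le_of_walk G hΔ R i
      refine ⟨S, hw i .nil (Nat.zero_le _), ?_, fun v hv => ?_⟩
      · rw [zero_add, one_pow] at hS
        generalize 0 ^ (4 * R) = c
        omega
      · obtain ⟨w, hl⟩ := walk v hv
        exact hw v w hl
    · obtain ⟨S, hS, hw⟩ := exists_card_le_two_of_walk G (fun i => (hΔ i).trans h1) i
      refine ⟨S, hw i .nil, ?_, fun v hv => hw v (walk v hv).choose⟩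
      have := Nat.one_le_pow (4 * R) Δ hpos
      omega
  · obtain ⟨S, hS, hw⟩ := exists_card_le_of_walk G hΔ R i
    refine ⟨S, hw i .nil (Nat.zero_le _), ?_, fun v hv => ?_⟩
    · have h2 : (Δ + 1) ^ R ≤ Δ ^ (4 * R) := by
        rw [pow_mul]
        refine Nat.pow_le_pow_left ?_ R
        calc Δ + 1 ≤ Δ ^ 2 := by nlinarith
          _ ≤ Δ ^ 4 := Nat.pow_le_pow_right (by omega) (by norm_num)
      omega
    · obtain ⟨w, hl⟩ := walk v hv
      exact hw v w hl

lemma card_biUnion_terms_le {V ι : Type*} [DecidableEq V] [Fintype ι] {k T : ℕ} {X : ι → Finset V}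
    (hX : ∀ a, (X a).card ≤ k) (i : V)
    (hT : (Finset.univ.filter fun a => i ∈ X a).card ≤ T) :
    (insert i ((Finset.univ.filter fun a => i ∈ X a).biUnion fun a => (X a).erase i)).card ≤
      (k - 1) * T + 1 := by
  refine (Finset.card_insert_le _ _).trans (Nat.add_le_add_right ?_ 1)
  refine (Finset.card_biUnion_le_card_mul _ _ (k - 1) fun a ha => ?_).trans ?_
  · rw [Finset.card_erase_of_mem (Finset.mem_filter.1 ha).2]
    exact Nat.sub_le_sub_right (hX a) 1
  · rw [mul_comm]
    exact Nat.mul_le_mul_left _ hT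

lemma stringSpan_mono {P Q : Finset V → Prop} (h : ∀ X, P X → Q X) :
    (stringSpan P : Submodule ℂ (Operator V)) ≤ stringSpan Q :=
  Submodule.span_mono fun _ ⟨l, m, hl, hm, hP, hA⟩ => ⟨l, m, hl, hm, h _ hP, hA⟩

end Dicke

theorem theorem2 {V : Type*} [Fintype V] [DecidableEq V] :
    -- Hamiltonians that are `k`-local and of range `R` on a graph of maximum degree `Δ`
    (∀ (G : SimpleGraph V) [DecidableRel G.Adj] (Δ k R : ℕ) (H : Dicke.Operator V) (E : ℕ → ℂ),
      (∀ i : V, G.degree i ≤ Δ) →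
      Dicke.IsKLocal k H →
      Dicke.HasRange G R H →
      2 * k * (Δ ^ (4 * R) + 1) < Fintype.card V →
      (∀ p ≤ Fintype.card V, H *ᵥ Dicke.dicke p = E p • Dicke.dicke p) →
      ∃ Ω ω : ℂ, (∀ p ≤ Fintype.card V, E p = Ω + ω * (p : ℂ)) ∧
        (H.IsHermitian → Ω.im = 0 ∧ ω.im = 0)) ∧
    -- Hamiltonians `H = ∑ a, h a` whose terms act on at most `k` sites each, every site being
    -- part of at most `T` terms; no graph is given
    (∀ (ι : Type*) [Fintype ι] (k T : ℕ) (X : ι → Finset V) (h : ι → Dicke.Operator V)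
      (E : ℕ → ℂ),
      (∀ a, (X a).card ≤ k) →
      (∀ a, Dicke.SupportedOn (X a) (h a)) →
      (∀ i : V, (Finset.univ.filter fun a => i ∈ X a).card ≤ T) →
      2 * k * (((k - 1) * T) ^ 8 + 1) < Fintype.card V →
      (∀ p ≤ Fintype.card V, (∑ a, h a) *ᵥ Dicke.dicke p = E p • Dicke.dicke p) →
      ∃ Ω ω : ℂ, (∀ p ≤ Fintype.card V, E p = Ω + ω * (p : ℂ)) ∧
        ((∑ a, h a).IsHermitian → Ω.im = 0 ∧ ω.im = 0)) := by
  refine ⟨?_, ?_⟩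
  · intro G _ Δ k R H E hΔ hk hR hN hE
    have hV : 0 < Fintype.card V := by omega
    rcases Nat.eq_zero_or_pos k with rfl | hkpos
    · exact Dicke.affine_spectrum_of_card_le_zero (fun _ h => h) hV hk hE
    obtain ⟨i⟩ := Fintype.card_pos_iff.1 hV
    obtain ⟨S, hi, hS, hball⟩ := Dicke.exists_ball_card_lt G hΔ R i
    refine Dicke.affine_spectrum_of_neighborhood hR hE hi (hS.trans_le ?_)
      fun X hX hiX j hj => hball j (hX i hiX j hj)
    refine le_trans (Nat.mul_le_mul_right _ ?_) hN.le
    omega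
  · intro ι _ k T X h E hX hh hT hN hE
    have hV : 0 < Fintype.card V := by omega
    have hH : ∑ a, h a ∈ Dicke.stringSpan (fun Y : Finset V => ∃ a, Y ⊆ X a) :=
      Submodule.sum_mem _ fun a _ => Dicke.stringSpan_mono (fun _ hY => ⟨a, hY⟩) (hh a)
    rcases Nat.eq_zero_or_pos k with rfl | hkpos
    · exact Dicke.affine_spectrum_of_card_le_zero
        (fun _ ⟨a, ha⟩ => (Finset.card_le_card ha).trans (hX a)) hV hH hE
    obtain ⟨i⟩ := Fintype.card_pos_iff.1 hV
    refine Dicke.affine_spectrum_of_neighborhood hH hE (Finset.mem_insert_self i _)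
      ((Dicke.card_biUnion_terms_le hX i (hT i)).trans_lt ?_) fun Y ⟨a, ha⟩ hiY j hj => ?_
    · have h1 : (k - 1) * T ≤ ((k - 1) * T) ^ 8 := Nat.le_self_pow (by norm_num) _
      have h2 := Nat.mul_le_mul_right (((k - 1) * T) ^ 8 + 1) (show 1 ≤ 2 * k by omega)
      omega
    · by_cases hji : j = i
      · simp [hji]
      · exact Finset.mem_insert_of_mem (Finset.mem_biUnion.2
          ⟨a, by simpa using ha hiY, Finset.mem_erase.2 ⟨hji, ha hj⟩⟩)
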